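/- All rings are associative with identity, not necessarily commutative. For a ring $S$ let $\mathrm{nil}(S)$ be its set of nilpotent elements and $P(S)$ its prime radical (the intersection of all prime two-sided ideals); $S$ is \emph{2-primal} if $P(S)=\mathrm{nil}(S)$. The \emph{nilpotent graph} $\Gamma_N(S)$ has as vertices the non-zero elements $a\in S$ such that $ab\in\mathrm{nil}(S)$ for some non-zero $b\in S$, and two distinct vertices $a,b$ are adjacent iff $ab\in\mathrm{nil}(S)$. The \emph{girth} $gr(\Gamma)$ of a graph is the length of a shortest cycle, and $\infty$ if there is no cycle. Let $A=\sigma(R)\langle x_1,\dots,x_n\rangle$ be a skew PBW extension of $R$. That is: $R$ is a subring of $A$ with the same identity; $A$ is a free left $R$-module with basis the monomials $x^\alpha=x_1^{\alpha_1}\cdots x_n^{\alpha_n}$, $\alpha\in\mathbb{N}^n$; for every $i$ and every non-zero $r\in R$ there is a non-zero $c_{i,r}\in R$ with $x_ir-c_{i,r}x_i\in R$; and for all $i,j$ there is a non-zero $d_{i,j}\in R$ with $x_jx_i-d_{i,j}x_ix_j\in R+Rx_1+\cdots+Rx_n$. Let $\sigma_i$ and $\delta_i$ be the (uniquely determined)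 injective endomorphism and $\sigma_i$-derivation of $R$ with $x_ir=\sigma_i(r)x_i+\delta_i(r)$ for all $r\in R$, and put $\sigma^\alpha=\sigma_1^{\alpha_1}\circ\cdots\circ\sigma_n^{\alpha_n}$ and $\delta^\alpha=\delta_1^{\alpha_1}\circ\cdots\circ\delta_n^{\alpha_n}$. Suppose that $R$ is \emph{$(\Sigma,\Delta)$-compatible}: for all $a,b\in R$ and $\alpha\in\mathbb{N}^n$, $a\sigma^\alpha(b)=0$ if and only if $ab=0$, and $ab=0$ implies $a\delta^\alpha(b)=0$. \textbf{Theorem.} If, in addition, $R$ is 2-primal, then $$gr(\Gamma_N(R))\ \ge\ gr(\Gamma_N(\sigma(R)\langle x_1,\dots,x_n\rangle)).$$ Moreover, if $\Gamma_N(R)$ contains a cycle, then $$gr(\Gamma_N(R))=gr(\Gamma_N(\sigma(R)\langle x_1,\dots,x_n\rangle)).$$ -/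

import Mathlib

/-- A two-sided ideal `P` of a (not necessarily commutative) ring is prime if it is proper and
`a S b ⊆ P` implies `a ∈ P` or `b ∈ P`. -/
structure IsPrimeTwoSided {S : Type*} [Ring S] (P : TwoSidedIdeal S) : Prop where
  ne_top : P ≠ ⊤
  mem_or_mem : ∀ a b : S, (∀ r : S, a * r * b ∈ P) → a ∈ P ∨ b ∈ P

/-- The prime radical: the intersection of all prime (two-sided) ideals. -/
def primeRadical (S : Type*) [Ring S] : TwoSidedIdeal S :=
  sInf {P : TwoSidedIdeal S | IsPrimeTwoSided P}

/-- A ring is 2-primal if its prime radical is the set of its nilpotent elements. -/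
def IsTwoPrimal (S : Type*) [Ring S] : Prop :=
  (primeRadical S : Set S) = {a : S | IsNilpotent a}

theorem isNilpotent_mul_swap {S : Type*} [Ring S] {a b : S} (h : IsNilpotent (a * b)) :
    IsNilpotent (b * a) := by
  obtain ⟨k, hk⟩ := h
  refine ⟨k + 1, ?_⟩
  have key : ∀ m : ℕ, (b * a) ^ (m + 1) = b * (a * b) ^ m * a := by
    intro m
    induction m with
    | zero => simp
    | succ m ih => rw [pow_succ, ih, pow_succ (a * b)]; simp only [mul_assoc]
  rw [key, hk, mul_zero, zero_mul]

/-- The set `Z_N(S)* = Z_N(S) \ {0}`, where `Z_N(S)` consists of all `a` such that `ab` is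
nilpotent for some non-zero `b`. -/
def nilZeroDivisors (S : Type*) [Ring S] : Set S :=
  {a : S | a ≠ 0 ∧ ∃ b : S, b ≠ 0 ∧ IsNilpotent (a * b)}

/-- The nilpotent graph `Γ_N(S)`: distinct vertices `a`, `b` are adjacent iff `ab` is nilpotent. -/
def nilpotentGraph (S : Type*) [Ring S] : SimpleGraph (nilZeroDivisors S) where
  Adj a b := a ≠ b ∧ IsNilpotent ((a : S) * (b : S))
  symm := ⟨fun _ _ h => ⟨h.1.symm, isNilpotent_mul_swap h.2⟩⟩
  loopless := ⟨fun _ h => h.1 rfl⟩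

/-- The standard monomial `x₁^α₁ ⋯ xₙ^αₙ` (in this order). -/
def stdMonomial {A : Type*} [Ring A] {n : ℕ} (x : Fin n → A) (α : Fin n → ℕ) : A :=
  (List.ofFn fun i => x i ^ α i).prod

/-- `A` is a skew PBW extension `σ(R)⟨x₁, …, xₙ⟩` of its subring `R`. -/
structure IsSkewPBWExtension {A : Type*} [Ring A] (R : Subring A) {n : ℕ} (x : Fin n → A) :
    Prop where
  linearIndependent : LinearIndependent R (stdMonomial x)
  span_eq_top : Submodule.span R (Set.range (stdMonomial x)) = ⊤
  exists_coeff : ∀ (i : Fin n) (r : R), r ≠ 0 →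
    ∃ c : R, c ≠ 0 ∧ x i * (r : A) - (c : A) * x i ∈ R
  exists_comm : ∀ i j : Fin n, ∃ d : R, d ≠ 0 ∧ ∃ (r₀ : R) (r : Fin n → R),
    x j * x i - (d : A) * x i * x j = (r₀ : A) + ∑ k, (r k : A) * x k

namespace IsSkewPBWExtension

variable {A : Type*} [Ring A] {R : Subring A} {n : ℕ} {x : Fin n → A}

theorem stdMonomial_zero (x : Fin n → A) : stdMonomial x 0 = 1 := by
  simp [stdMonomial]

theorem stdMonomial_single (x : Fin n → A) (i : Fin n) : stdMonomial x (Pi.single i 1) = x i := by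
  unfold stdMonomial
  induction n with
  | zero => exact i.elim0
  | succ n ih =>
    rw [List.ofFn_succ, List.prod_cons]
    refine Fin.cases ?_ (fun j => ?_) i
    · have : (fun j : Fin n => x j.succ ^ (Pi.single 0 1 : Fin (n + 1) → ℕ) j.succ)
          = fun _ => 1 := by
        funext j
        simp
      rw [this]
      simp
    · have : (fun k : Fin n => x k.succ ^ (Pi.single j.succ 1 : Fin (n + 1) → ℕ) k.succ)
          = fun k : Fin n => x k.succ ^ (Pi.single j 1 : Fin n → ℕ) k := by
        funext k
        simp [Pi.single_apply]
      rw [this, ih (fun k => x k.succ) j]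
      simp [Fin.succ_ne_zero, eq_comm]

/-- The basis of standard monomials of the left `R`-module `A`. -/
noncomputable def basis (h : IsSkewPBWExtension R x) : Module.Basis (Fin n → ℕ) R A :=
  Module.Basis.mk h.linearIndependent h.span_eq_top.ge

/-- The coefficient of `xᵢ` in `xᵢ r`. -/
noncomputable def sigmaFun (h : IsSkewPBWExtension R x) (i : Fin n) (r : R) : R :=
  h.basis.repr (x i * (r : A)) (Pi.single i 1)

/-- The constant coefficient of `xᵢ r`. -/
noncomputable def deltaFun (h : IsSkewPBWExtension R x) (i : Fin n) (r : R) : R :=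
  h.basis.repr (x i * (r : A)) 0

theorem repr_linear (h : IsSkewPBWExtension R x) (i : Fin n) (c d : R) :
    h.basis.repr ((c : A) * x i + (d : A)) =
      Finsupp.single (Pi.single i 1) c + Finsupp.single 0 d := by
  have h1 : (c : A) * x i + (d : A) =
      c • h.basis (Pi.single i 1) + d • h.basis (0 : Fin n → ℕ) := by
    simp [basis, stdMonomial_zero, stdMonomial_single, Subring.smul_def]
  rw [h1, map_add, map_smul, map_smul, Module.Basis.repr_self, Module.Basis.repr_self]
  simp

theorem eq_of_mul_eq (h : IsSkewPBWExtension R x) {i : Fin n} {r c d : R}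
    (e : x i * (r : A) = (c : A) * x i + (d : A)) :
    h.sigmaFun i r = c ∧ h.deltaFun i r = d := by
  have hne : (Pi.single i 1 : Fin n → ℕ) ≠ 0 := by simp
  unfold sigmaFun deltaFun
  rw [e, repr_linear]
  constructor <;> simp [hne, hne.symm]

theorem mul_eq_fun (h : IsSkewPBWExtension R x) (i : Fin n) (r : R) :
    x i * (r : A) = (h.sigmaFun i r : A) * x i + (h.deltaFun i r : A) := by
  have : ∃ c d : R, x i * (r : A) = (c : A) * x i + (d : A) := by
    by_cases hr : r = 0
    · exact ⟨0, 0, by simp [hr]⟩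
    · obtain ⟨c, -, hc⟩ := h.exists_coeff i r hr
      exact ⟨c, ⟨_, hc⟩, by simp⟩
  obtain ⟨c, d, e⟩ := this
  obtain ⟨h1, h2⟩ := h.eq_of_mul_eq e
  rw [h1, h2, e]

/-- The endomorphism `σᵢ` of `R` determined by `xᵢ r = σᵢ(r) xᵢ + δᵢ(r)`. -/
noncomputable def sigma (h : IsSkewPBWExtension R x) (i : Fin n) : R →+* R where
  toFun := h.sigmaFun i
  map_one' := (h.eq_of_mul_eq (i := i) (r := 1) (c := 1) (d := 0) (by simp)).1
  map_zero' := (h.eq_of_mul_eq (i := i) (r := 0) (c := 0) (d := 0) (by simp)).1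
  map_add' r s := (h.eq_of_mul_eq (d := h.deltaFun i r + h.deltaFun i s) (by
    push_cast
    rw [mul_add, h.mul_eq_fun i r, h.mul_eq_fun i s, add_mul]; abel)).1
  map_mul' r s := (h.eq_of_mul_eq
    (d := h.sigmaFun i r * h.deltaFun i s + h.deltaFun i r * s) (by
    push_cast
    rw [← mul_assoc, h.mul_eq_fun i r, add_mul, mul_assoc, h.mul_eq_fun i s, mul_add]
    simp only [mul_assoc, add_assoc])).1

/-- The `σᵢ`-derivation `δᵢ` of `R` determined by `xᵢ r = σᵢ(r) xᵢ + δᵢ(r)`. -/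
noncomputable def delta (h : IsSkewPBWExtension R x) (i : Fin n) : R →+ R where
  toFun := h.deltaFun i
  map_zero' := (h.eq_of_mul_eq (i := i) (r := 0) (c := 0) (d := 0) (by simp)).2
  map_add' r s := (h.eq_of_mul_eq (c := h.sigmaFun i r + h.sigmaFun i s) (by
    push_cast
    rw [mul_add, h.mul_eq_fun i r, h.mul_eq_fun i s, add_mul]; abel)).2

theorem mul_eq (h : IsSkewPBWExtension R x) (i : Fin n) (r : R) :
    x i * (r : A) = (h.sigma i r : A) * x i + (h.delta i r : A) :=
  h.mul_eq_fun i r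

theorem delta_mul (h : IsSkewPBWExtension R x) (i : Fin n) (r s : R) :
    h.delta i (r * s) = h.sigma i r * h.delta i s + h.delta i r * s :=
  (h.eq_of_mul_eq (c := h.sigma i r * h.sigma i s) (by
    push_cast
    rw [← mul_assoc, h.mul_eq i r, add_mul, mul_assoc, h.mul_eq i s, mul_add]
    simp only [mul_assoc, add_assoc])).2

theorem sigma_injective (h : IsSkewPBWExtension R x) (i : Fin n) :
    Function.Injective (h.sigma i) := by
  rw [injective_iff_map_eq_zero]
  intro r hr
  by_contra hne
  obtain ⟨c, hc, hm⟩ := h.exists_coeff i r hne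
  have e : h.sigma i r = c :=
    (h.eq_of_mul_eq (i := i) (r := r) (c := c) (d := ⟨_, hm⟩) (by simp)).1
  exact hc (e.symm.trans hr)

end IsSkewPBWExtension

/-- The composition `f₁^α₁ ∘ ⋯ ∘ fₙ^αₙ`. -/
def iterComp {S : Type*} {n : ℕ} (f : Fin n → S → S) (α : Fin n → ℕ) : S → S :=
  (List.ofFn fun i => (f i)^[α i]).foldr (fun g k => g ∘ k) id

/-- `S` is `Σ`-compatible: `a σ^α(b) = 0 ↔ a b = 0`. -/
def IsSigmaCompatible {S : Type*} [Ring S] {n : ℕ} (σ : Fin n → S →+* S) : Prop :=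
  ∀ (a b : S) (α : Fin n → ℕ), a * iterComp (fun i => ⇑(σ i)) α b = 0 ↔ a * b = 0

/-- `S` is `Δ`-compatible: `a b = 0 → a δ^β(b) = 0`. -/
def IsDeltaCompatible {S : Type*} [Ring S] {n : ℕ} (δ : Fin n → S →+ S) : Prop :=
  ∀ (a b : S) (β : Fin n → ℕ), a * b = 0 → a * iterComp (fun i => ⇑(δ i)) β b = 0

/- A nonzero `a` with `a ^ 2 = 0` already forces a triangle in `Γ_N(S)` as soon as there is a
cycle: either `a` is adjacent to every other vertex, or some `a * b` is not nilpotent and `a`,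
`a * b`, `b * a` are pairwise adjacent. If `S` is reduced, adjacency means `a * b = 0`, and a
path `a - b - c - d` gives the triangle `b`, `c`, `a * d` or, when `a * d = 0`, a 4-cycle. So
the girth of `Γ_N(R)` is 3 or 4 once there is a cycle, and it is 3 when `R` is not reduced. If
`R` is reduced, the leading coefficients, for the degree-lexicographic order, of elements of `A`
with product zero have product zero as well, so `A` is reduced and each triangle of `Γ_N(A)`
gives one of `Γ_N(R)`. -/

section Graph

open SimpleGraph

variable {V : Type*} {G : SimpleGraph V}

theorem egirth_le_three_iff_exists_triangle :
    G.egirth ≤ 3 ↔ ∃ a b c, G.Adj a b ∧ G.Adj b c ∧ G.Adj c a := by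
  classical
  calc G.egirth ≤ 3 ↔ ∃ (v : V) (w : G.Walk v v), w.IsCycle ∧ w.length = 3 := by
        refine ⟨fun h => ?_, fun ⟨v, w, hw, hl⟩ => hw.egirth_le_length.trans_eq (by simp [hl])⟩
        have hcyc : ¬ G.IsAcyclic := fun hac => by simp [hac.egirth_eq_top] at h
        obtain ⟨v, w, hw, hl⟩ := exists_egirth_eq_length.mpr hcyc
        exact ⟨v, w, hw, le_antisymm (by exact_mod_cast hl ▸ h) hw.three_le_length⟩
    _ ↔ ∃ a b c, G.Adj a b ∧ G.Adj b c ∧ G.Adj c a := by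
        rw [← is3Clique_iff_exists_cycle_length_three]
        simp only [is3Clique_iff]
        exact ⟨fun ⟨_, a, b, c, hab, hac, hbc, _⟩ => ⟨a, b, c, hab, hbc, hac.symm⟩,
          fun ⟨a, b, c, hab, hbc, hca⟩ => ⟨_, a, b, c, hab, hca.symm, hbc, rfl⟩⟩

theorem egirth_le_four_of_adj {a b c d : V} (hab : G.Adj a b) (hbc : G.Adj b c)
    (hcd : G.Adj c d) (hda : G.Adj d a) (hac : a ≠ c) (hbd : b ≠ d) : G.egirth ≤ 4 := by
  have hw : (Walk.cons hab (.cons hbc (.cons hcd (.cons hda .nil)))).IsCycle := by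
    simp [Walk.cons_isCycle_iff, hab.ne, hab.ne', hbc.ne, hcd.ne, hda.ne, hda.ne', hac.symm, hbd,
      hac]
  simpa using hw.egirth_le_length

theorem exists_nonbacktracking_walk_of_not_isAcyclic (hG : ¬ G.IsAcyclic) :
    ∃ a b c d, G.Adj a b ∧ G.Adj b c ∧ G.Adj c d ∧ a ≠ c ∧ b ≠ d := by
  obtain ⟨v, w, hw, -⟩ := exists_egirth_eq_length.mpr hG
  have hl := hw.three_le_length
  exact ⟨_, _, _, _, w.adj_getVert_succ (i := 0) (by lia), w.adj_getVert_succ (i := 1) (by lia),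
    w.adj_getVert_succ (i := 2) (by lia), hw.getVert_sub_one_ne_getVert_add_one (i := 1) (by lia),
    hw.getVert_sub_one_ne_getVert_add_one (i := 2) (by lia)⟩

theorem egirth_le_three_of_isUniversal {u : V} (hu : G.IsUniversal u) (hG : ¬ G.IsAcyclic) :
    G.egirth ≤ 3 := by
  have of_edge {b c : V} (hbc : G.Adj b c) (hub : u ≠ b) (huc : u ≠ c) : G.egirth ≤ 3 :=
    egirth_le_three_iff_exists_triangle.mpr ⟨u, b, c, hu hub, hbc, (hu huc).symm⟩
  obtain ⟨a, b, c, d, hab, hbc, hcd, hac, hbd⟩ := exists_nonbacktracking_walk_of_not_isAcyclic hG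
  by_cases hua : u = a
  · exact of_edge hbc (hua ▸ hab.ne) (hua ▸ hac)
  by_cases hub : u = b
  · exact of_edge hcd (hub ▸ hbc.ne) (hub ▸ hbd)
  · exact of_edge hab hua hub

end Graph

section NilpotentGraph

theorem nilpotentGraph_isContained {S T : Type*} [Ring S] [Ring T] {f : S →+* T}
    (hf : Function.Injective f) : (nilpotentGraph S).IsContained (nilpotentGraph T) := by
  let F : nilZeroDivisors S → nilZeroDivisors T := fun a =>
    ⟨f a, (map_ne_zero_iff f hf).mpr a.2.1, by
      obtain ⟨b, hb, hab⟩ := a.2.2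
      exact ⟨f b, (map_ne_zero_iff f hf).mpr hb, by simpa using hab.map f⟩⟩
  have hF : Function.Injective F := fun a b h => Subtype.ext (hf (congrArg Subtype.val h))
  exact ⟨⟨⟨F, fun {a b} h => ⟨fun e => h.1 (hF e), by simpa [F] using h.2.map f⟩⟩, hF⟩⟩

variable {S : Type*} [Ring S]

theorem nilpotentGraph_egirth_le_three_of_isNilpotent_mul {a b c : S} (ha : a ≠ 0) (hb : b ≠ 0)
    (hc : c ≠ 0) (hab : IsNilpotent (a * b)) (hbc : IsNilpotent (b * c))
    (hca : IsNilpotent (c * a)) (hab_ne : a ≠ b) (hbc_ne : b ≠ c) (hca_ne : c ≠ a) :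
    (nilpotentGraph S).egirth ≤ 3 :=
  egirth_le_three_iff_exists_triangle.mpr
    ⟨⟨a, ha, b, hb, hab⟩, ⟨b, hb, c, hc, hbc⟩, ⟨c, hc, a, ha, hca⟩,
      ⟨fun e => hab_ne (congrArg Subtype.val e), hab⟩,
      ⟨fun e => hbc_ne (congrArg Subtype.val e), hbc⟩,
      ⟨fun e => hca_ne (congrArg Subtype.val e), hca⟩⟩

theorem nilpotentGraph_egirth_le_three_of_not_isReduced (hS : ¬ IsReduced S)
    (hcyc : ¬ (nilpotentGraph S).IsAcyclic) : (nilpotentGraph S).egirth ≤ 3 := by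
  obtain ⟨a, ha0, ha⟩ : ∃ a : S, a ≠ 0 ∧ a * a = 0 := by
    simpa [isReduced_iff_pow_one_lt 2 one_lt_two, sq, and_comm] using hS
  have hnil : IsNilpotent (a * a) := ha ▸ IsNilpotent.zero
  by_cases huniv : ∀ b : S, IsNilpotent (a * b)
  · exact egirth_le_three_of_isUniversal (u := ⟨a, ha0, a, ha0, hnil⟩)
      (fun b hb => ⟨hb, huniv b⟩) hcyc
  push Not at huniv
  obtain ⟨b, hab⟩ := huniv
  have hba : ¬ IsNilpotent (b * a) := fun h => hab (isNilpotent_mul_swap h)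
  have h₁ : a * (a * b) = 0 := by rw [← mul_assoc, ha, zero_mul]
  have h₂ : (b * a) * (a * b) = 0 := by rw [mul_assoc, h₁, mul_zero]
  have h₃ : (b * a) * a = 0 := by rw [mul_assoc, ha, mul_zero]
  have hcomm : a * b ≠ b * a := fun e => hab ⟨2, by rw [sq, ← h₂, e]⟩
  have ne_of {y : S} (hy : ¬ IsNilpotent y) : y ≠ 0 ∧ y ≠ a :=
    ⟨fun e => hy (e ▸ IsNilpotent.zero), fun e => hy ⟨2, by rw [e, sq, ha]⟩⟩
  exact nilpotentGraph_egirth_le_three_of_isNilpotent_mul ha0 (ne_of hab).1 (ne_of hba).1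
    (h₁ ▸ IsNilpotent.zero) (isNilpotent_mul_swap (h₂ ▸ IsNilpotent.zero)) (h₃ ▸ IsNilpotent.zero)
    (ne_of hab).2.symm hcomm (ne_of hba).2

section Reduced

variable [IsReduced S]

theorem mul_eq_zero_symm_of_isReduced {a b : S} (h : a * b = 0) : b * a = 0 :=
  (isNilpotent_mul_swap (h ▸ IsNilpotent.zero)).eq_zero

theorem mul_mul_eq_zero_of_isReduced {a b : S} (h : a * b = 0) (r : S) : a * r * b = 0 :=
  mul_eq_zero_symm_of_isReduced (by rw [← mul_assoc, mul_eq_zero_symm_of_isReduced h, zero_mul])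

theorem ne_of_mul_eq_zero_of_isReduced {a b : S} (ha : a ≠ 0) (h : a * b = 0) : a ≠ b := by
  rintro rfl
  exact ha (pow_eq_zero_iff two_ne_zero |>.mp (by rw [sq, h]))

theorem nilpotentGraph_adj_iff {a b : nilZeroDivisors S} :
    (nilpotentGraph S).Adj a b ↔ (a : S) * (b : S) = 0 :=
  ⟨fun h => h.2.eq_zero, fun h =>
    ⟨fun e => ne_of_mul_eq_zero_of_isReduced a.2.1 h (congrArg Subtype.val e),
      h ▸ IsNilpotent.zero⟩⟩

theorem nilpotentGraph_egirth_le_three_iff :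
    (nilpotentGraph S).egirth ≤ 3 ↔
      ∃ a b c : S, (a ≠ 0 ∧ b ≠ 0 ∧ c ≠ 0) ∧ a * b = 0 ∧ b * c = 0 ∧ c * a = 0 := by
  refine ⟨fun h => ?_, fun ⟨a, b, c, ⟨ha, hb, hc⟩, hab, hbc, hca⟩ => ?_⟩
  · obtain ⟨a, b, c, hab, hbc, hca⟩ := egirth_le_three_iff_exists_triangle.mp h
    exact ⟨a, b, c, ⟨a.2.1, b.2.1, c.2.1⟩, nilpotentGraph_adj_iff.mp hab,
      nilpotentGraph_adj_iff.mp hbc, nilpotentGraph_adj_iff.mp hca⟩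
  · exact nilpotentGraph_egirth_le_three_of_isNilpotent_mul ha hb hc (hab ▸ IsNilpotent.zero)
      (hbc ▸ IsNilpotent.zero) (hca ▸ IsNilpotent.zero) (ne_of_mul_eq_zero_of_isReduced ha hab)
      (ne_of_mul_eq_zero_of_isReduced hb hbc) (ne_of_mul_eq_zero_of_isReduced hc hca)

theorem nilpotentGraph_egirth_le_four (hcyc : ¬ (nilpotentGraph S).IsAcyclic) :
    (nilpotentGraph S).egirth ≤ 4 := by
  obtain ⟨a, b, c, d, hab, hbc, hcd, hac, hbd⟩ :=
    exists_nonbacktracking_walk_of_not_isAcyclic hcyc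
  by_cases had : (a : S) * d = 0
  · exact egirth_le_four_of_adj hab hbc hcd (nilpotentGraph_adj_iff.mpr had).symm hac hbd
  have hcad : (c : S) * (a * d) = 0 := by
    rw [← mul_assoc, mul_mul_eq_zero_of_isReduced (nilpotentGraph_adj_iff.mp hcd)]
  have hadb : (a * d : S) * b = 0 :=
    mul_mul_eq_zero_of_isReduced (nilpotentGraph_adj_iff.mp hab) _
  have htri : (nilpotentGraph S).egirth ≤ 3 := nilpotentGraph_egirth_le_three_iff.mpr
    ⟨b, c, a * d, ⟨b.2.1, c.2.1, had⟩, nilpotentGraph_adj_iff.mp hbc, hcad, hadb⟩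
  exact htri.trans (by norm_num)

end Reduced

end NilpotentGraph

section Exponents

variable {n : ℕ}

/-- The total degree of an exponent `α`, that is, the degree of the monomial `x ^ α`. -/
def expDegree (α : Fin n → ℕ) : ℕ := ∑ i, α i

@[simp]
theorem expDegree_zero : expDegree (0 : Fin n → ℕ) = 0 := by
  simp [expDegree]

@[simp]
theorem expDegree_single (i : Fin n) : expDegree (Pi.single i 1) = 1 := by
  simp [expDegree]

@[simp]
theorem expDegree_add (α β : Fin n → ℕ) : expDegree (α + β) = expDegree α + expDegree β :=
  Finset.sum_add_distrib

/-- The key by which exponents are compared in the degree-lexicographic order: first the total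
degree, then the lexicographic order. -/
def degLexKey (α : Fin n → ℕ) : ℕ ×ₗ Lex (Fin n → ℕ) :=
  toLex (expDegree α, toLex α)

theorem degLexKey_add (α β : Fin n → ℕ) :
    degLexKey (α + β) = degLexKey α + degLexKey β := by
  rw [degLexKey, expDegree_add]
  rfl

theorem degLexKey_injective : Function.Injective (degLexKey (n := n)) := fun _ _ h =>
  congrArg (fun p : ℕ ×ₗ Lex (Fin n → ℕ) => ofLex (ofLex p).2) h

theorem expDegree_le_of_degLexKey_le {α β : Fin n → ℕ} (h : degLexKey α ≤ degLexKey β) :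
    expDegree α ≤ expDegree β :=
  (Prod.Lex.le_iff.mp h).elim le_of_lt fun h => h.1.le

theorem exists_eq_add_single {α : Fin n → ℕ} (hα : α ≠ 0) :
    ∃ (i : Fin n) (β : Fin n → ℕ), α = β + Pi.single i 1 ∧ ∀ k < i, β k = 0 := by
  obtain ⟨i, hi, hmin⟩ := WellFounded.has_min (wellFounded_lt (α := Fin n)) {i | α i ≠ 0}
    (Function.ne_iff.mp hα)
  refine ⟨i, α - Pi.single i 1, (tsub_add_cancel_of_le ?_).symm, fun k hk => ?_⟩
  · intro k
    rcases eq_or_ne k i with rfl | hk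
    · simpa [Nat.one_le_iff_ne_zero] using hi
    · simp [hk]
  · have : α k = 0 := not_not.mp fun h => hmin k h hk
    simp [this]

end Exponents

section Generators

variable {n : ℕ}

theorem prod_ofFn_pow_single {M : Type*} [Monoid M] (f : Fin n → M) (i : Fin n) :
    (List.ofFn fun k => f k ^ (Pi.single i 1 : Fin n → ℕ) k).prod = f i := by
  rw [List.ofFn_eq_map, List.prod_map_eq_pow_single i]
  · simp [List.count_eq_one_of_mem (List.nodup_finRange n) (List.mem_finRange i)]
  · intro k hk _
    simp [hk]

theorem iterComp_single {S : Type*} (f : Fin n → S → S) (i : Fin n) :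
    iterComp f (Pi.single i 1) = f i :=
  prod_ofFn_pow_single (M := Function.End S) f i

theorem IsSigmaCompatible.mul_eq_zero_of_mul_sigma_eq_zero {S : Type*} [Ring S]
    {σ : Fin n → S →+* S} (hσ : IsSigmaCompatible σ) (i : Fin n) (a b : S) (h : a * σ i b = 0) :
    a * b = 0 :=
  (hσ a b (Pi.single i 1)).mp (by rwa [iterComp_single])

theorem gen_mul_stdMonomial {A : Type*} [Ring A] (x : Fin n → A) {i : Fin n} {α : Fin n → ℕ}
    (h : ∀ k < i, α k = 0) : x i * stdMonomial x α = stdMonomial x (α + Pi.single i 1) := by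
  have stdMonomial_succ {m : ℕ} (x : Fin (m + 1) → A) (α : Fin (m + 1) → ℕ) :
      stdMonomial x α = x 0 ^ α 0 * stdMonomial (Fin.tail x) (Fin.tail α) := by
    simp [stdMonomial, List.ofFn_succ, Fin.tail]
  induction n with
  | zero => exact i.elim0
  | succ n ih =>
    rw [stdMonomial_succ, stdMonomial_succ]
    cases i using Fin.cases with
    | zero =>
      have htail : Fin.tail (α + Pi.single 0 1) = Fin.tail α := by
        funext k
        simp [Fin.tail]
      rw [htail, ← mul_assoc, ← pow_succ']
      simp
    | succ j =>
      have htail : Fin.tail (α + Pi.single j.succ 1) = Fin.tail α + Pi.single j 1 := by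
        funext k
        simp [Fin.tail, Pi.single_apply]
      have hj : ∀ k < j, Fin.tail α k = 0 := fun k hk => h k.succ (Fin.succ_lt_succ_iff.mpr hk)
      rw [htail, ← ih (Fin.tail x) hj]
      simp [h 0 (Fin.succ_pos j), Fin.tail]

end Generators

theorem add_smodEq_left {R M : Type*} [Ring R] [AddCommGroup M] [Module R M] {U : Submodule R M}
    (a : M) {b : M} (hb : b ∈ U) : a + b ≡ a [SMOD U] := by
  simpa using (SModEq.refl a).add (SModEq.zero.mpr hb)

namespace IsSkewPBWExtension

variable {A : Type*} [Ring A] {R : Subring A} {n : ℕ} {x : Fin n → A}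

/-- The left `R`-submodule of `A` spanned by the standard monomials of total degree less than
`m`. -/
def degreeLT (R : Subring A) (x : Fin n → A) (m : ℕ) : Submodule R A :=
  Submodule.span R (stdMonomial x '' {α | expDegree α < m})

theorem degreeLT_mono : Monotone (degreeLT R x) := fun _ _ h =>
  Submodule.span_mono (Set.image_mono fun _ hα => lt_of_lt_of_le hα h)

theorem stdMonomial_mem_degreeLT {m : ℕ} {α : Fin n → ℕ} (h : expDegree α < m) :
    stdMonomial x α ∈ degreeLT R x m :=
  Submodule.subset_span ⟨α, h, rfl⟩

theorem coe_basis (h : IsSkewPBWExtension R x) : ⇑h.basis = stdMonomial x :=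
  Module.Basis.coe_mk _ _

theorem repr_stdMonomial (h : IsSkewPBWExtension R x) (α : Fin n → ℕ) :
    h.basis.repr (stdMonomial x α) = Finsupp.single α 1 := by
  rw [← h.coe_basis, Module.Basis.repr_self]

theorem repr_eq_of_smodEq_degreeLT (h : IsSkewPBWExtension R x) {m : ℕ} {y z : A}
    (hyz : y ≡ z [SMOD degreeLT R x m]) {α : Fin n → ℕ} (hα : m ≤ expDegree α) :
    h.basis.repr y α = h.basis.repr z α := by
  have hmem := SModEq.sub_mem.mp hyz
  rw [degreeLT, ← h.coe_basis, Module.Basis.mem_span_image] at hmem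
  rw [← sub_eq_zero, ← Finsupp.sub_apply, ← map_sub]
  exact Finsupp.notMem_support_iff.mp fun hmem' => (hmem hmem').not_ge hα

theorem gen_mul_smul (h : IsSkewPBWExtension R x) (i : Fin n) (r : R) (y : A) :
    x i * r • y = h.sigma i r • (x i * y) + h.delta i r • y := by
  simp only [Subring.smul_def, smul_eq_mul, ← mul_assoc, h.mul_eq, add_mul]

theorem gen_mul_smul_stdMonomial_smodEq (h : IsSkewPBWExtension R x) (i : Fin n) (r : R)
    (α : Fin n → ℕ) :
    x i * r • stdMonomial x α ≡ h.sigma i r • (x i * stdMonomial x α)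
      [SMOD degreeLT R x (expDegree α + 1)] := by
  rw [h.gen_mul_smul]
  exact add_smodEq_left _
    (Submodule.smul_mem _ _ (stdMonomial_mem_degreeLT (Nat.lt_succ_self _)))

theorem add_sum_mem_degreeLT_two (r₀ : R) (r : Fin n → R) :
    (r₀ : A) + ∑ k, (r k : A) * x k ∈ degreeLT R x 2 := by
  have hone : (1 : A) ∈ degreeLT R x 2 :=
    stdMonomial_zero x ▸ stdMonomial_mem_degreeLT (by simp)
  have hgen (k : Fin n) : x k ∈ degreeLT R x 2 :=
    stdMonomial_single x k ▸ stdMonomial_mem_degreeLT (by simp)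
  refine add_mem ?_ (sum_mem fun k _ => Submodule.smul_mem _ (r k) (hgen k))
  simpa [Subring.smul_def] using Submodule.smul_mem _ r₀ hone

/- Exchanging `xᵢ` and `xⱼ` twice must reproduce the leading term `xⱼ xᵢ`, which makes the
structure constant `d` left invertible. -/
theorem exists_leftInvertible_swap (h : IsSkewPBWExtension R x) {i j : Fin n} (hji : j < i) :
    ∃ d e : R, e * d = 1 ∧ ∃ (r₀ : R) (r : Fin n → R),
      x i * x j = d • (x j * x i) + ((r₀ : A) + ∑ k, (r k : A) * x k) := by
  obtain ⟨d, -, r₀, r, hd⟩ := h.exists_comm j i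
  obtain ⟨e, -, s₀, s, he⟩ := h.exists_comm i j
  rw [mul_assoc, sub_eq_iff_eq_add'] at hd he
  refine ⟨d, e, ?_, r₀, r, hd⟩
  have hij : x i * x j ≡ d • (x j * x i) [SMOD degreeLT R x 2] :=
    hd ▸ add_smodEq_left _ (add_sum_mem_degreeLT_two r₀ r)
  have hji' : x j * x i ≡ e • (x i * x j) [SMOD degreeLT R x 2] :=
    he ▸ add_smodEq_left _ (add_sum_mem_degreeLT_two s₀ s)
  have hstd : x j * x i = stdMonomial x (Pi.single i 1 + Pi.single j 1) := by
    rw [← gen_mul_stdMonomial x fun k hk => Pi.single_eq_of_ne (hk.trans hji).ne 1,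
      stdMonomial_single]
  have hcoeff := h.repr_eq_of_smodEq_degreeLT (hji'.trans (hij.smul e))
    (α := Pi.single i 1 + Pi.single j 1) (by simp)
  simpa [hstd, h.repr_stdMonomial, eq_comm] using hcoeff

theorem gen_mul_mem_degreeLT_of_forall_smodEq (h : IsSkewPBWExtension R x) {m : ℕ}
    (hm : ∀ (i : Fin n) (β : Fin n → ℕ), expDegree β < m → ∃ u : R,
      x i * stdMonomial x β ≡ u • stdMonomial x (β + Pi.single i 1)
        [SMOD degreeLT R x (expDegree β + 1)])
    (i : Fin n) {y : A} (hy : y ∈ degreeLT R x m) : x i * y ∈ degreeLT R x (m + 1) := by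
  induction hy using Submodule.span_induction with
  | mem y hy =>
    obtain ⟨β, hβ, rfl⟩ := hy
    obtain ⟨u, hu⟩ := hm i β hβ
    have hlead : u • stdMonomial x (β + Pi.single i 1) ∈ degreeLT R x (m + 1) :=
      Submodule.smul_mem _ _ (stdMonomial_mem_degreeLT (by simpa using hβ))
    have hrest := degreeLT_mono (Nat.succ_le_succ hβ.le) (SModEq.sub_mem.mp hu)
    simpa using add_mem hrest hlead
  | zero => simp
  | add y z _ _ hy hz => exact mul_add (x i) y z ▸ add_mem hy hz
  | smul r y hy' hy =>
    rw [h.gen_mul_smul]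
    exact add_mem (Submodule.smul_mem _ _ hy)
      (Submodule.smul_mem _ _ (degreeLT_mono m.le_succ hy'))

theorem exists_smodEq_of_swap (h : IsSkewPBWExtension R x) {i j : Fin n} (hji : j < i)
    {γ : Fin n → ℕ} (hγ : ∀ k < j, γ k = 0)
    (hmul : ∀ (k : Fin n) {y : A}, y ∈ degreeLT R x (expDegree γ + 1) →
      x k * y ∈ degreeLT R x (expDegree γ + 2))
    {u v : R} (hvu : v * u = 1)
    (hu : x i * stdMonomial x γ ≡ u • stdMonomial x (γ + Pi.single i 1)
      [SMOD degreeLT R x (expDegree γ + 1)]) :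
    ∃ u' v' : R, v' * u' = 1 ∧
      x i * stdMonomial x (γ + Pi.single j 1) ≡
        u' • stdMonomial x (γ + Pi.single j 1 + Pi.single i 1)
        [SMOD degreeLT R x (expDegree γ + 2)] := by
  obtain ⟨d, e, hed, r₀, r, hd⟩ := h.exists_leftInvertible_swap hji
  refine ⟨d * h.sigma j u, h.sigma j v * e, ?_, ?_⟩
  · rw [mul_assoc, ← mul_assoc e, hed, one_mul, ← map_mul, hvu, map_one]
  have hγi : ∀ k < j, (γ + Pi.single i 1 : Fin n → ℕ) k = 0 := fun k hk => by
    simp [hγ k hk, (hk.trans hji).ne]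
  have hγmem : stdMonomial x γ ∈ degreeLT R x (expDegree γ + 1) :=
    stdMonomial_mem_degreeLT (Nat.lt_succ_self _)
  have hlower : ((r₀ : A) + ∑ k, (r k : A) * x k) * stdMonomial x γ
      ∈ degreeLT R x (expDegree γ + 2) := by
    simp only [add_mul, Finset.sum_mul, mul_assoc]
    exact add_mem (Submodule.smul_mem _ r₀ (degreeLT_mono (Nat.le_succ _) hγmem))
      (sum_mem fun k _ => Submodule.smul_mem _ (r k) (hmul k hγmem))
  have hju : x j * (x i * stdMonomial x γ) ≡ x j * u • stdMonomial x (γ + Pi.single i 1)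
      [SMOD degreeLT R x (expDegree γ + 2)] := by
    rw [SModEq.sub_mem, ← mul_sub]
    exact hmul j (SModEq.sub_mem.mp hu)
  have hσ := h.gen_mul_smul_stdMonomial_smodEq j u (γ + Pi.single i 1)
  rw [gen_mul_stdMonomial x hγi, add_right_comm, expDegree_add, expDegree_single] at hσ
  calc x i * stdMonomial x (γ + Pi.single j 1)
      = d • (x j * (x i * stdMonomial x γ))
          + ((r₀ : A) + ∑ k, (r k : A) * x k) * stdMonomial x γ := by
        rw [← gen_mul_stdMonomial x hγ, ← mul_assoc, hd, add_mul, smul_mul_assoc, mul_assoc]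
    _ ≡ d • (x j * (x i * stdMonomial x γ)) [SMOD degreeLT R x (expDegree γ + 2)] :=
        add_smodEq_left _ hlower
    _ ≡ d • h.sigma j u • stdMonomial x (γ + Pi.single j 1 + Pi.single i 1)
          [SMOD degreeLT R x (expDegree γ + 2)] := (hju.trans hσ).smul d
    _ = (d * h.sigma j u) • stdMonomial x (γ + Pi.single j 1 + Pi.single i 1) := smul_smul _ _ _

theorem exists_gen_mul_stdMonomial_smodEq (h : IsSkewPBWExtension R x) (i : Fin n)
    (β : Fin n → ℕ) :
    ∃ u v : R, v * u = 1 ∧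
      x i * stdMonomial x β ≡ u • stdMonomial x (β + Pi.single i 1)
        [SMOD degreeLT R x (expDegree β + 1)] := by
  induction hm : expDegree β using Nat.strong_induction_on generalizing i β with
  | _ m ih =>
  subst hm
  have hmul := h.gen_mul_mem_degreeLT_of_forall_smodEq (m := expDegree β) fun i γ hγ =>
    (ih _ hγ i γ rfl).imp fun _ ⟨_, _, hu⟩ => hu
  by_cases hi : ∀ k < i, β k = 0
  · exact ⟨1, 1, one_mul 1, by rw [gen_mul_stdMonomial x hi, one_smul]⟩
  have hβ : β ≠ 0 := by
    rintro rfl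
    exact hi fun _ _ => rfl
  obtain ⟨j, γ, rfl, hγ⟩ := exists_eq_add_single hβ
  have hji : j < i := by
    by_contra! hij
    exact hi fun k hk => by simp [hγ k (hk.trans_le hij), (hk.trans_le hij).ne]
  rw [expDegree_add, expDegree_single] at ih hmul ⊢
  obtain ⟨u, v, hvu, hu⟩ := ih _ (Nat.lt_succ_self _) i γ rfl
  exact h.exists_smodEq_of_swap hji hγ hmul hvu hu

theorem gen_mul_mem_degreeLT (h : IsSkewPBWExtension R x) (i : Fin n) {m : ℕ} {y : A}
    (hy : y ∈ degreeLT R x m) : x i * y ∈ degreeLT R x (m + 1) :=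
  h.gen_mul_mem_degreeLT_of_forall_smodEq
    (fun i β _ => (h.exists_gen_mul_stdMonomial_smodEq i β).imp fun _ ⟨_, _, hu⟩ => hu) i hy

theorem sum_repr_smul_stdMonomial (h : IsSkewPBWExtension R x) (f : A) :
    ∑ α ∈ (h.basis.repr f).support, h.basis.repr f α • stdMonomial x α = f := by
  conv_rhs => rw [← h.basis.linearCombination_repr f, Finsupp.linearCombination_apply, h.coe_basis]
  rfl

/-- `α` is the largest exponent, in the degree-lexicographic order, of a standard monomial occurring
in `f`. -/
def IsLeadingExponent (h : IsSkewPBWExtension R x) (f : A) (α : Fin n → ℕ) : Prop :=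
  α ∈ (h.basis.repr f).support ∧ ∀ β ∈ (h.basis.repr f).support, degLexKey β ≤ degLexKey α

theorem exists_isLeadingExponent (h : IsSkewPBWExtension R x) {f : A} (hf : f ≠ 0) :
    ∃ α, h.IsLeadingExponent f α :=
  Finset.exists_max_image _ degLexKey (by simpa using hf)

theorem IsLeadingExponent.repr_ne_zero {h : IsSkewPBWExtension R x} {f : A} {α : Fin n → ℕ}
    (hf : h.IsLeadingExponent f α) : h.basis.repr f α ≠ 0 :=
  Finsupp.mem_support_iff.mp hf.1

theorem IsLeadingExponent.expDegree_add_le {h : IsSkewPBWExtension R x} {f g : A}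
    {α β α' β' : Fin n → ℕ} (hf : h.IsLeadingExponent f α) (hg : h.IsLeadingExponent g β)
    (hα' : α' ∈ (h.basis.repr f).support) (hβ' : β' ∈ (h.basis.repr g).support) :
    expDegree (α' + β') ≤ expDegree (α + β) := by
  simpa only [expDegree_add] using add_le_add (expDegree_le_of_degLexKey_le (hf.2 _ hα'))
    (expDegree_le_of_degLexKey_le (hg.2 _ hβ'))

theorem IsLeadingExponent.eq_of_add_eq_add {h : IsSkewPBWExtension R x} {f g : A}
    {α β α' β' : Fin n → ℕ} (hf : h.IsLeadingExponent f α) (hg : h.IsLeadingExponent g β)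
    (hα' : α' ∈ (h.basis.repr f).support) (hβ' : β' ∈ (h.basis.repr g).support)
    (e : α' + β' = α + β) : α' = α ∧ β' = β := by
  have hkey := congrArg degLexKey e
  rw [degLexKey_add, degLexKey_add,
    add_eq_add_iff_eq_and_eq (hf.2 _ hα') (hg.2 _ hβ')] at hkey
  exact ⟨degLexKey_injective hkey.1, degLexKey_injective hkey.2⟩

section Reduced

variable [IsReduced R]

theorem exists_stdMonomial_mul_smodEq (h : IsSkewPBWExtension R x)
    (hσ : ∀ (i : Fin n) (a b : R), a * h.sigma i b = 0 → a * b = 0) (α β : Fin n → ℕ) (r : R) :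
    ∃ s : R, (∀ a, a * s = 0 → a * r = 0) ∧
      stdMonomial x α * r • stdMonomial x β ≡ s • stdMonomial x (α + β)
        [SMOD degreeLT R x (expDegree (α + β))] := by
  induction hm : expDegree α generalizing α with
  | zero =>
    obtain rfl : α = 0 := by
      funext k
      simpa using Finset.sum_eq_zero_iff.mp hm k (Finset.mem_univ k)
    exact ⟨r, fun _ => id, by rw [stdMonomial_zero, one_mul, zero_add]⟩
  | succ m ih =>
    obtain ⟨i, γ, rfl, hγ⟩ := exists_eq_add_single (α := α) (by rintro rfl; simp at hm)
    obtain ⟨s, hs, hmem⟩ := ih γ (by simpa using hm)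
    obtain ⟨u, v, hvu, hu⟩ := h.exists_gen_mul_stdMonomial_smodEq i (γ + β)
    refine ⟨h.sigma i s * u, fun a ha => hs a (hσ i a s ?_), ?_⟩
    · have hua : u * (a * h.sigma i s) = 0 :=
        mul_eq_zero_symm_of_isReduced (by rw [mul_assoc, ha])
      rw [← one_mul (a * _), ← hvu, mul_assoc, hua, mul_zero]
    have hdeg : expDegree (γ + Pi.single i 1 + β) = expDegree (γ + β) + 1 := by
      rw [add_right_comm, expDegree_add _ (Pi.single i 1), expDegree_single]
    rw [hdeg]
    calc stdMonomial x (γ + Pi.single i 1) * r • stdMonomial x β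
        = x i * (stdMonomial x γ * r • stdMonomial x β) := by
          rw [← gen_mul_stdMonomial x hγ, mul_assoc]
      _ ≡ x i * s • stdMonomial x (γ + β) [SMOD degreeLT R x (expDegree (γ + β) + 1)] := by
          rw [SModEq.sub_mem, ← mul_sub]
          exact h.gen_mul_mem_degreeLT i (SModEq.sub_mem.mp hmem)
      _ ≡ h.sigma i s • (x i * stdMonomial x (γ + β))
            [SMOD degreeLT R x (expDegree (γ + β) + 1)] :=
          h.gen_mul_smul_stdMonomial_smodEq i s (γ + β)
      _ ≡ h.sigma i s • u • stdMonomial x (γ + β + Pi.single i 1)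
            [SMOD degreeLT R x (expDegree (γ + β) + 1)] := hu.smul _
      _ = (h.sigma i s * u) • stdMonomial x (γ + Pi.single i 1 + β) := by
          rw [smul_smul, add_right_comm]

theorem IsLeadingExponent.exists_repr_mul_add {h : IsSkewPBWExtension R x}
    (hσ : ∀ (i : Fin n) (a b : R), a * h.sigma i b = 0 → a * b = 0) {f g : A} {α β : Fin n → ℕ}
    (hf : h.IsLeadingExponent f α) (hg : h.IsLeadingExponent g β) :
    ∃ s : R, (∀ a, a * s = 0 → a * h.basis.repr g β = 0) ∧
      h.basis.repr (f * g) (α + β) = h.basis.repr f α * s := by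
  choose s hs hmod using h.exists_stdMonomial_mul_smodEq hσ
  have hexpand : f * g = ∑ p ∈ (h.basis.repr f).support ×ˢ (h.basis.repr g).support,
      h.basis.repr f p.1 • (stdMonomial x p.1 * h.basis.repr g p.2 • stdMonomial x p.2) := by
    conv_lhs => rw [← h.sum_repr_smul_stdMonomial f, ← h.sum_repr_smul_stdMonomial g,
      Finset.sum_mul_sum, ← Finset.sum_product']
    simp only [smul_mul_assoc]
  have hterm : ∀ p ∈ (h.basis.repr f).support ×ˢ (h.basis.repr g).support,
      h.basis.repr (stdMonomial x p.1 * h.basis.repr g p.2 • stdMonomial x p.2) (α + β)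
        = Finsupp.single (p.1 + p.2) (s p.1 p.2 (h.basis.repr g p.2)) (α + β) := fun p hp => by
    obtain ⟨hα', hβ'⟩ := Finset.mem_product.mp hp
    rw [h.repr_eq_of_smodEq_degreeLT (hmod _ _ _) (hf.expDegree_add_le hg hα' hβ'), map_smul,
      repr_stdMonomial, Finsupp.smul_single_one]
  refine ⟨s α β (h.basis.repr g β), hs α β _, ?_⟩
  have hmem := Finset.mk_mem_product hf.1 hg.1
  simp only [hexpand, map_sum, Finsupp.finsetSum_apply, map_smul, Finsupp.smul_apply, smul_eq_mul]
  rw [Finset.sum_eq_single_of_mem (α, β) hmem, hterm _ hmem, Finsupp.single_eq_same]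
  intro p hp hne
  obtain ⟨hα', hβ'⟩ := Finset.mem_product.mp hp
  have hsum : p.1 + p.2 ≠ α + β := fun e =>
    hne (Prod.ext_iff.mpr (hf.eq_of_add_eq_add hg hα' hβ' e))
  rw [hterm p hp, Finsupp.single_eq_of_ne hsum.symm, mul_zero]

theorem IsLeadingExponent.repr_mul_repr_eq_zero {h : IsSkewPBWExtension R x}
    (hσ : ∀ (i : Fin n) (a b : R), a * h.sigma i b = 0 → a * b = 0) {f g : A} {α β : Fin n → ℕ}
    (hf : h.IsLeadingExponent f α) (hg : h.IsLeadingExponent g β) (hfg : f * g = 0) :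
    h.basis.repr f α * h.basis.repr g β = 0 := by
  obtain ⟨s, hs, hcoeff⟩ := hf.exists_repr_mul_add hσ hg
  exact hs _ (by rw [← hcoeff, hfg, map_zero, Finsupp.zero_apply])

theorem isReduced (h : IsSkewPBWExtension R x)
    (hσ : ∀ (i : Fin n) (a b : R), a * h.sigma i b = 0 → a * b = 0) : IsReduced A := by
  rw [isReduced_iff_pow_one_lt 2 one_lt_two]
  intro f hf
  by_contra hne
  obtain ⟨α, hα⟩ := h.exists_isLeadingExponent hne
  rw [sq] at hf
  exact ne_of_mul_eq_zero_of_isReduced hα.repr_ne_zero (hα.repr_mul_repr_eq_zero hσ hα hf) rfl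

theorem nilpotentGraph_egirth_le_three_of_egirth_le_three (h : IsSkewPBWExtension R x)
    (hσ : ∀ (i : Fin n) (a b : R), a * h.sigma i b = 0 → a * b = 0)
    (hA : (nilpotentGraph A).egirth ≤ 3) : (nilpotentGraph R).egirth ≤ 3 := by
  have := h.isReduced hσ
  obtain ⟨f, g, k, ⟨hf, hg, hk⟩, hfg, hgk, hkf⟩ := nilpotentGraph_egirth_le_three_iff.mp hA
  obtain ⟨α, hα⟩ := h.exists_isLeadingExponent hf
  obtain ⟨β, hβ⟩ := h.exists_isLeadingExponent hg
  obtain ⟨γ, hγ⟩ := h.exists_isLeadingExponent hk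
  exact nilpotentGraph_egirth_le_three_iff.mpr ⟨_, _, _,
    ⟨hα.repr_ne_zero, hβ.repr_ne_zero, hγ.repr_ne_zero⟩, hα.repr_mul_repr_eq_zero hσ hβ hfg,
    hβ.repr_mul_repr_eq_zero hσ hγ hgk, hγ.repr_mul_repr_eq_zero hσ hα hkf⟩

end Reduced

end IsSkewPBWExtension

theorem mainTheorem4_general {A : Type*} [Ring A] (R : Subring A) {n : ℕ} (x : Fin n → A)
    (hA : IsSkewPBWExtension R x)
    (hσ : ∀ (i : Fin n) (a b : R), a * hA.sigma i b = 0 → a * b = 0) :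
    (nilpotentGraph A).egirth ≤ (nilpotentGraph R).egirth ∧
      ((∃ (v : nilZeroDivisors R) (w : (nilpotentGraph R).Walk v v), w.IsCycle) →
        (nilpotentGraph R).egirth = (nilpotentGraph A).egirth) := by
  have hle : (nilpotentGraph A).egirth ≤ (nilpotentGraph R).egirth :=
    (nilpotentGraph_isContained R.subtype_injective).egirth_le
  refine ⟨hle, fun ⟨v, w, hw⟩ => le_antisymm ?_ hle⟩
  have hcyc : ¬ (nilpotentGraph R).IsAcyclic := fun hac => hac w hw
  by_cases h3 : (nilpotentGraph R).egirth ≤ 3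
  · exact h3.trans SimpleGraph.three_le_egirth
  have : IsReduced R := not_not.mp fun hred =>
    h3 (nilpotentGraph_egirth_le_three_of_not_isReduced hred hcyc)
  have hA3 : 3 < (nilpotentGraph A).egirth := not_le.mp fun hA3 =>
    h3 (hA.nilpotentGraph_egirth_le_three_of_egirth_le_three hσ hA3)
  exact (nilpotentGraph_egirth_le_four hcyc).trans (Order.add_one_le_of_lt hA3)

theorem mainTheorem4 {A : Type*} [Ring A] (R : Subring A) {n : ℕ} (x : Fin n → A)
    (hA : IsSkewPBWExtension R x)
    (hS : IsSigmaCompatible hA.sigma) (hD : IsDeltaCompatible hA.delta)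
    (hR : IsTwoPrimal R) :
    (nilpotentGraph A).egirth ≤ (nilpotentGraph R).egirth ∧
      ((∃ (v : nilZeroDivisors R) (w : (nilpotentGraph R).Walk v v), w.IsCycle) →
        (nilpotentGraph R).egirth = (nilpotentGraph A).egirth) :=
  mainTheorem4_general R x hA hS.mul_eq_zero_of_mul_sigma_eq_zero
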